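/- Fix $c\in\mathbb{C}$, put $g(x,y)=c/(x-y)$, and let $D\subseteq\mathbb{C}$ be a set with $-D=D$ (for instance $D=\mathbb{C}$). Let $\mathcal{R}_3$ be the algebra over $\mathbb{C}$ with generators $T_{ij}(u)$ ($1\le i,j\le 3$, $u\in D$) and the relations $R_{12}(u,v)T_1(u)T_2(v)=T_2(v)T_1(u)R_{12}(u,v)$ for $u\neq v$, where $R(u,v)=\mathbb{I}+g(u,v)P$ and $P$ is the permutation of $\mathbb{C}^3\otimes\mathbb{C}^3$, with central symbols $\lambda_i(u)$ ($1\le i\le 3$, $u\in D$) adjoined. Let $|0\rangle$ be the vacuum vector: formal vectors are expressions $X|0\rangle$ with $X\in\mathcal{R}_3$, subject to $T_{ii}(u)|0\rangle=\lambda_i(u)|0\rangle$ and $T_{ij}(u)|0\rangle=0$ for $i>j$. A model is a complex vector space $H$ with operators $T_{ij}(u)$ satisfying the same relations, functions $\lambda_i:D\to\mathbb{C}$ and a vector $|0\rangle\in H$ with the same vacuum properties; a formal vector $X|0\rangle$ is realized in a model by substituting its operators, functions and vacuum. The transformed model is the same space and vacuum with $\tilde T_{ij}(u)=T_{4-j,4-i}(-u)$,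 $\tilde\lambda_i(u)=\lambda_{4-i}(-u)$. For $\bar u=(u_1,\dots,u_a)$ and $\bar v=(v_1,\dots,v_b)$ in $D$ with $v_k\ne u_j$ for all $j,k$, the off-shell Bethe vector is $$|\Psi_{a,b}(\bar u;\bar v)\rangle=\mathbb{B}_1(u_1)\cdots\mathbb{B}_a(u_a)\,\widehat{\mathcal{B}}^{(a)}(v_1)\cdots\widehat{\mathcal{B}}^{(a)}(v_b)\,|0\rangle\otimes|\Omega^{(a)}\rangle .$$ Here $\mathbb{B}(u)=(T_{12}(u),T_{13}(u))$, where $\mathbb{B}_k$ is a row vector in the $k$-th factor of $(\mathbb{C}^2)^{\otimes a}$; $\widehat{\mathcal{B}}^{(a)}(z)$ is the upper right entry, in the auxiliary space $V_0=\mathbb{C}^2$, of $\mathbb{D}_0(z)r_{0a}(z,u_a)\cdots r_{01}(z,u_1)$, where $\mathbb{D}(z)=(T_{ij}(z))_{i,j=2,3}$, $r(x,y)=1+g(x,y)p$, $p$ is the permutation of $\mathbb{C}^2\otimes\mathbb{C}^2$, and $\Omega^{(a)}=\binom10^{\otimes a}$. Let $\varphi$ be the automorphism $\varphi(T_{ij}(u))=T_{4-j,4-i}(-u)$,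 $\varphi(\lambda_i(u))=\lambda_{4-i}(-u)$, extended to formal vectors by $\varphi(X|0\rangle)=\varphi(X)|0\rangle$. Then for all $a,b\ge 0$ and all such $\bar u,\bar v$ $$\varphi\bigl(|\Psi_{a,b}(\bar u;\bar v)\rangle\bigr)=|\Psi_{b,a}(-\bar v;-\bar u)\rangle .$$ Moreover, in every model the formal Bethe vector $|\Psi_{a,b}(\bar u;\bar v)\rangle$ is realized by the Bethe vector of that model, and $\varphi(|\Psi_{a,b}(\bar u;\bar v)\rangle)$ is realized by the Bethe vector with indices $b,a$ and parameters $(-\bar v;-\bar u)$ of that model. In particular, realized in the transformed model, $\varphi(|\Psi_{a,b}(\bar u;\bar v)\rangle)$ becomes $|\widetilde\Psi_{b,a}(-\bar v;-\bar u)\rangle$, the Bethe vector built from $\tilde T$; and in every model $|\Psi_{a,b}(\bar u;\bar v)\rangle=|\widetilde\Psi_{b,a}(-\bar v;-\bar u)\rangle$. -/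

import Mathlib

open scoped Kronecker

namespace NABA

noncomputable section

/-! ### Rational functions and spectral parameters -/

/-- `g(x,y) = c / (x - y)`. -/
def g (c x y : ℂ) : ℂ := c / (x - y)

/-- A set of admissible values of the spectral parameter, stable under `z ↦ -z`
(for instance all of `ℂ`, or `ℂ` without the poles of the monodromy matrix and their negatives). -/
structure SpectralDomain where
  carrier : Set ℂ
  neg_mem : ∀ z ∈ carrier, -z ∈ carrier

instance : CoeSort SpectralDomain Type := ⟨fun D => D.carrier⟩

instance (D : SpectralDomain) : Neg D := ⟨fun z => ⟨-(z : ℂ), D.neg_mem z z.2⟩⟩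

theorem SpectralDomain.coe_neg (D : SpectralDomain) (z : D) : ((-z : D) : ℂ) = -(z : ℂ) := rfl

theorem SpectralDomain.neg_neg (D : SpectralDomain) (z : D) : -(-z) = z :=
  Subtype.ext (_root_.neg_neg (z : ℂ))

theorem g_neg_neg (c x y : ℂ) : g c (-y) (-x) = g c x y := by
  unfold g; congr 1; ring

/-! ### The RTT relation

The indices `1, 2, 3` are `0, 1, 2 : Fin 3`; the involution `i ↦ 4 - i` is `Fin.rev`. -/

section RTT

variable {A B : Type*} [Ring A] [Algebra ℂ A] [Ring B] [Algebra ℂ B]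

/-- The permutation matrix `P = ∑ E_ij ⊗ E_ji` of `ℂ³ ⊗ ℂ³`. -/
def permP (A : Type*) [Ring A] : Matrix (Fin 3 × Fin 3) (Fin 3 × Fin 3) A :=
  Matrix.of fun p q => if p = q.swap then 1 else 0

/-- `R(x,y) = 𝕀 + g(x,y) P`. -/
def R (A : Type*) [Ring A] [Algebra ℂ A] (c x y : ℂ) :
    Matrix (Fin 3 × Fin 3) (Fin 3 × Fin 3) A :=
  1 + g c x y • permP A

/-- The left-hand side `R₁₂(x,y) X₁ Y₂` of the RTT relation, `X = T(x)`, `Y = T(y)`. -/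
def rttLeft (c x y : ℂ) (X Y : Matrix (Fin 3) (Fin 3) A) :
    Matrix (Fin 3 × Fin 3) (Fin 3 × Fin 3) A :=
  R A c x y * (X ⊗ₖ (1 : Matrix (Fin 3) (Fin 3) A)) * ((1 : Matrix (Fin 3) (Fin 3) A) ⊗ₖ Y)

/-- The right-hand side `Y₂ X₁ R₁₂(x,y)` of the RTT relation. -/
def rttRight (c x y : ℂ) (X Y : Matrix (Fin 3) (Fin 3) A) :
    Matrix (Fin 3 × Fin 3) (Fin 3 × Fin 3) A :=
  ((1 : Matrix (Fin 3) (Fin 3) A) ⊗ₖ Y) * (X ⊗ₖ (1 : Matrix (Fin 3) (Fin 3) A)) * R A c x y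

/-- The RTT relation `R₁₂(u,v) T₁(u) T₂(v) = T₂(v) T₁(u) R₁₂(u,v)`. -/
def IsRTT (c : ℂ) {D : SpectralDomain} (T : D → Matrix (Fin 3) (Fin 3) A) : Prop :=
  ∀ u v : D, u ≠ v → rttLeft c u v (T u) (T v) = rttRight c u v (T u) (T v)

/-- The transformed monodromy matrix `T̃_{ij}(u) = T_{4-j,4-i}(-u)`. -/
def tilde {D : SpectralDomain} (T : D → Matrix (Fin 3) (Fin 3) A) :
    D → Matrix (Fin 3) (Fin 3) A :=
  fun u => Matrix.of fun i j => T (-u) j.rev i.rev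

theorem rttLeft_apply (c x y : ℂ) (X Y : Matrix (Fin 3) (Fin 3) A) (i j k l : Fin 3) :
    rttLeft c x y X Y (i, k) (j, l) = X i j * Y k l + g c x y • (X k j * Y i l) := by
  have h : (X ⊗ₖ (1 : Matrix (Fin 3) (Fin 3) A)) * ((1 : Matrix (Fin 3) (Fin 3) A) ⊗ₖ Y)
      = Matrix.of fun p q => X p.1 q.1 * Y p.2 q.2 := by
    ext ⟨i, k⟩ ⟨j, l⟩
    simp [Matrix.mul_apply, Fintype.sum_prod_type, Matrix.one_apply]
  have hP : permP A * (Matrix.of fun p q : Fin 3 × Fin 3 => X p.1 q.1 * Y p.2 q.2)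
      = Matrix.of fun p q => X p.2 q.1 * Y p.1 q.2 := by
    ext ⟨i, k⟩ ⟨j, l⟩
    simp [permP, Matrix.mul_apply, Fintype.sum_prod_type, Prod.ext_iff, ite_and]
  rw [rttLeft, Matrix.mul_assoc, h, R, Matrix.add_mul, Matrix.smul_mul, hP]
  simp

theorem rttRight_apply (c x y : ℂ) (X Y : Matrix (Fin 3) (Fin 3) A) (i j k l : Fin 3) :
    rttRight c x y X Y (i, k) (j, l) = Y k l * X i j + g c x y • (Y k j * X i l) := by
  have h : ((1 : Matrix (Fin 3) (Fin 3) A) ⊗ₖ Y) * (X ⊗ₖ (1 : Matrix (Fin 3) (Fin 3) A))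
      = Matrix.of fun p q => Y p.2 q.2 * X p.1 q.1 := by
    ext ⟨i, k⟩ ⟨j, l⟩
    simp [Matrix.mul_apply, Fintype.sum_prod_type, Matrix.one_apply]
  have hP : (Matrix.of fun p q : Fin 3 × Fin 3 => Y p.2 q.2 * X p.1 q.1) * permP A
      = Matrix.of fun p q => Y p.2 q.1 * X p.1 q.2 := by
    ext ⟨i, k⟩ ⟨j, l⟩
    simp [permP, Matrix.mul_apply, Fintype.sum_prod_type, Prod.ext_iff, ite_and]
  rw [rttRight, h, R, Matrix.mul_add, Matrix.mul_smul, hP]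
  simp

theorem map_rttLeft (f : A →ₐ[ℂ] B) (c x y : ℂ) (X Y : Matrix (Fin 3) (Fin 3) A)
    (p q : Fin 3 × Fin 3) :
    f (rttLeft c x y X Y p q) = rttLeft c x y (X.map f) (Y.map f) p q := by
  obtain ⟨i, k⟩ := p; obtain ⟨j, l⟩ := q
  simp [rttLeft_apply]

theorem map_rttRight (f : A →ₐ[ℂ] B) (c x y : ℂ) (X Y : Matrix (Fin 3) (Fin 3) A)
    (p q : Fin 3 × Fin 3) :
    f (rttRight c x y X Y p q) = rttRight c x y (X.map f) (Y.map f) p q := by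
  obtain ⟨i, k⟩ := p; obtain ⟨j, l⟩ := q
  simp [rttRight_apply]

theorem IsRTT.tilde {c : ℂ} {D : SpectralDomain} {T : D → Matrix (Fin 3) (Fin 3) A}
    (h : IsRTT c T) : IsRTT c (tilde T) := by
  intro u v huv
  ext ⟨i, k⟩ ⟨j, l⟩
  have hne : -v ≠ -u := fun e => huv (by
    rw [← D.neg_neg u, ← D.neg_neg v, e])
  have := congrFun (congrFun (h (-v) (-u) hne) (l.rev, j.rev)) (k.rev, i.rev)
  rw [rttLeft_apply, rttRight_apply, D.coe_neg, D.coe_neg, g_neg_neg] at this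
  rw [rttLeft_apply, rttRight_apply]
  exact this.symm

end RTT

/-! ### Off-shell Bethe vectors

`A` is an algebra of operators acting on the space `H`, and `T` is a monodromy matrix with entries
in `A`.  The space `H^{(a)} = ℂ² ⊗ ⋯ ⊗ ℂ²` (`a` factors) has the basis `Fin a → Fin 2`.
Operators on `H ⊗ H^{(a)}` are matrices over this basis with entries in `A`, vectors of
`H ⊗ H^{(a)}` are families of vectors of `H` indexed by this basis. -/

section Bethe

variable {A : Type*} [Ring A] [Algebra ℂ A] {D : SpectralDomain}

/-- The matrix unit `E_{βα}` acting in the `k`-th factor of `H^{(a)}`. -/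
def siteUnit (A : Type*) [Ring A] {a : ℕ} (k : Fin a) (β α : Fin 2) :
    Matrix (Fin a → Fin 2) (Fin a → Fin 2) A :=
  Matrix.of fun s t => if s k = β ∧ t k = α ∧ ∀ m, m ≠ k → s m = t m then 1 else 0

/-- `r_{0k}(z,x) = 1 + g(z,x) p_{0k}`, written as a `2 × 2` matrix in the auxiliary space `V₀`;
its `(α,β)` entry is `δ_{αβ} + g(z,x) E_{βα}` in the `k`-th factor. -/
def rMat (A : Type*) [Ring A] [Algebra ℂ A] (c : ℂ) {a : ℕ} (k : Fin a) (z x : ℂ) :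
    Matrix (Fin 2) (Fin 2) (Matrix (Fin a → Fin 2) (Fin a → Fin 2) A) :=
  1 + Matrix.of fun α β => g c z x • siteUnit A k β α

/-- The block `𝔻(z)` with entries `D_{αβ} = T_{α+1,β+1}`, acting trivially in `H^{(a)}`. -/
def blockD (T : D → Matrix (Fin 3) (Fin 3) A) (a : ℕ) (z : D) :
    Matrix (Fin 2) (Fin 2) (Matrix (Fin a → Fin 2) (Fin a → Fin 2) A) :=
  Matrix.of fun α β => Matrix.diagonal fun _ => T z α.succ β.succ

/-- `𝒯̂^{(a)}(z) = 𝔻₀(z) r_{0a}(z,u_a) ⋯ r_{01}(z,u_1)`. -/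
def That (c : ℂ) (T : D → Matrix (Fin 3) (Fin 3) A) {a : ℕ} (u : Fin a → D) (z : D) :
    Matrix (Fin 2) (Fin 2) (Matrix (Fin a → Fin 2) (Fin a → Fin 2) A) :=
  blockD T a z * (List.ofFn fun k : Fin a => rMat A c k z (u k)).reverse.prod

/-- The creation operator `ℬ̂^{(a)}(z)`, the upper right entry of `𝒯̂^{(a)}(z)`. -/
def Bhat (c : ℂ) (T : D → Matrix (Fin 3) (Fin 3) A) {a : ℕ} (u : Fin a → D) (z : D) :
    Matrix (Fin a → Fin 2) (Fin a → Fin 2) A :=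
  That c T u z 0 1

variable {H : Type*} [AddCommGroup H] [Module A H]

/-- `|0⟩ ⊗ |Ω^{(a)}⟩`, where `Ω^{(a)}` is the tensor product of `a` copies of `(1,0)`. -/
def vacOmega (vac : H) (a : ℕ) : (Fin a → Fin 2) → H :=
  Pi.single (fun _ => 0) vac

/-- `𝔽(ū;v̄)|0⟩ = ℬ̂^{(a)}(v_1) ⋯ ℬ̂^{(a)}(v_b) |0⟩ ⊗ |Ω^{(a)}⟩`. -/
def Fvec (c : ℂ) (T : D → Matrix (Fin 3) (Fin 3) A) (vac : H) {a b : ℕ}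
    (u : Fin a → D) (v : Fin b → D) : (Fin a → Fin 2) → H :=
  fun s => ∑ t, (List.ofFn fun k : Fin b => Bhat c T u (v k)).prod s t • vacOmega vac a t

/-- The off-shell Bethe vector
`|Ψ_{a,b}(ū;v̄)⟩ = 𝔹_1(u_1) ⋯ 𝔹_a(u_a) ℬ̂^{(a)}(v_1) ⋯ ℬ̂^{(a)}(v_b) |0⟩ ⊗ |Ω^{(a)}⟩`
of the monodromy matrix `T`, where `𝔹(u) = (T_{12}(u), T_{13}(u))`. -/
def betheVector (c : ℂ) (T : D → Matrix (Fin 3) (Fin 3) A) (vac : H) {a b : ℕ}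
    (u : Fin a → D) (v : Fin b → D) : H :=
  ∑ β : Fin a → Fin 2,
    (List.ofFn fun i : Fin a => T (u i) 0 (β i).succ).prod • Fvec c T vac u v β

end Bethe

/-! ### The algebra and its automorphism `φ` -/

/-- The generators `T_{ij}(u)` and the (formal) vacuum eigenvalues `λ_i(u)`. -/
inductive Gen (D : SpectralDomain) : Type
  | T (i j : Fin 3) (u : D) : Gen D
  | lam (i : Fin 3) (u : D) : Gen D

/-- The matrix of free generators `T_{ij}(u)`. -/
def freeT {D : SpectralDomain} (u : D) : Matrix (Fin 3) (Fin 3) (FreeAlgebra ℂ (Gen D)) :=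
  Matrix.of fun i j => FreeAlgebra.ι ℂ (Gen.T i j u)

/-- The defining relations: the RTT relation, and centrality of the scalars `λ_i(u)`. -/
inductive Rel (c : ℂ) (D : SpectralDomain) :
    FreeAlgebra ℂ (Gen D) → FreeAlgebra ℂ (Gen D) → Prop
  | rtt (u v : D) (huv : u ≠ v) (p q : Fin 3 × Fin 3) :
      Rel c D (rttLeft c u v (freeT u) (freeT v) p q) (rttRight c u v (freeT u) (freeT v) p q)
  | central (i : Fin 3) (u : D) (x : Gen D) :
      Rel c D (FreeAlgebra.ι ℂ (Gen.lam i u) * FreeAlgebra.ι ℂ x)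
        (FreeAlgebra.ι ℂ x * FreeAlgebra.ι ℂ (Gen.lam i u))

/-- The RTT algebra `ℛ₃`, with the functions `λ_i(u)` adjoined as central symbols. -/
abbrev RTTAlg (c : ℂ) (D : SpectralDomain) : Type := RingQuot (Rel c D)

/-- The monodromy matrix of generators of `RTTAlg`. -/
def genT (c : ℂ) (D : SpectralDomain) (u : D) : Matrix (Fin 3) (Fin 3) (RTTAlg c D) :=
  Matrix.of fun i j => RingQuot.mkAlgHom ℂ (Rel c D) (FreeAlgebra.ι ℂ (Gen.T i j u))

/-- The central symbols `λ_i(u)` of `RTTAlg`. -/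
def genLam (c : ℂ) (D : SpectralDomain) (i : Fin 3) (u : D) : RTTAlg c D :=
  RingQuot.mkAlgHom ℂ (Rel c D) (FreeAlgebra.ι ℂ (Gen.lam i u))

theorem genT_isRTT (c : ℂ) (D : SpectralDomain) : IsRTT c (genT c D) := by
  intro u v huv
  ext p q
  have h := RingQuot.mkAlgHom_rel ℂ (Rel.rtt (c := c) u v huv p q)
  rw [map_rttLeft, map_rttRight] at h
  exact h

theorem genLam_central (c : ℂ) (D : SpectralDomain) (i : Fin 3) (u : D) (x : Gen D) :
    genLam c D i u * RingQuot.mkAlgHom ℂ (Rel c D) (FreeAlgebra.ι ℂ x)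
      = RingQuot.mkAlgHom ℂ (Rel c D) (FreeAlgebra.ι ℂ x) * genLam c D i u := by
  have h := RingQuot.mkAlgHom_rel ℂ (Rel.central (c := c) i u x)
  rwa [map_mul, map_mul] at h

/-- The values on generators of the homomorphism given by `T_{ij}(u) ↦ T' u i j`,
`λ_i(u) ↦ lam' i u`. -/
def onGen {D : SpectralDomain} {B : Type*} (T' : D → Matrix (Fin 3) (Fin 3) B)
    (lam' : Fin 3 → D → B) : Gen D → B
  | Gen.T i j u => T' u i j
  | Gen.lam i u => lam' i u

/-- The homomorphism given by `T_{ij}(u) ↦ T' u i j`, `λ_i(u) ↦ lam' i u`. -/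
def liftAlg {c : ℂ} {D : SpectralDomain} {B : Type*} [Ring B] [Algebra ℂ B]
    (T' : D → Matrix (Fin 3) (Fin 3) B) (lam' : Fin 3 → D → B) (hT : IsRTT c T')
    (hlam : ∀ i u x, lam' i u * onGen T' lam' x = onGen T' lam' x * lam' i u) :
    RTTAlg c D →ₐ[ℂ] B :=
  RingQuot.liftAlgHom ℂ ⟨FreeAlgebra.lift ℂ (onGen T' lam'), by
    have hfree : ∀ u : D, (freeT u).map (FreeAlgebra.lift ℂ (onGen T' lam')) = T' u := by
      intro u; ext i j; simp [freeT, onGen]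
    intro x y h
    cases h with
    | rtt u v huv p q => rw [map_rttLeft, map_rttRight, hfree, hfree, hT u v huv]
    | central i u x => simpa [onGen] using hlam i u x⟩

@[simp] theorem liftAlg_genT {c : ℂ} {D : SpectralDomain} {B : Type*} [Ring B] [Algebra ℂ B]
    (T' : D → Matrix (Fin 3) (Fin 3) B) (lam' : Fin 3 → D → B) (hT : IsRTT c T') (hlam)
    (i j : Fin 3) (u : D) : liftAlg T' lam' hT hlam (genT c D u i j) = T' u i j := by
  simp [liftAlg, genT, onGen]

@[simp] theorem liftAlg_genLam {c : ℂ} {D : SpectralDomain} {B : Type*} [Ring B] [Algebra ℂ B]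
    (T' : D → Matrix (Fin 3) (Fin 3) B) (lam' : Fin 3 → D → B) (hT : IsRTT c T') (hlam)
    (i : Fin 3) (u : D) : liftAlg T' lam' hT hlam (genLam c D i u) = lam' i u := by
  simp [liftAlg, genLam, onGen]

/-- `φ` as a homomorphism: `T_{ij}(u) ↦ T_{4-j,4-i}(-u)`, `λ_i(u) ↦ λ_{4-i}(-u)`. -/
def phiHom (c : ℂ) (D : SpectralDomain) : RTTAlg c D →ₐ[ℂ] RTTAlg c D :=
  liftAlg (tilde (genT c D)) (fun i u => genLam c D i.rev (-u)) (genT_isRTT c D).tilde (by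
    rintro i u (⟨k, l, v⟩ | ⟨k, v⟩)
    · exact genLam_central c D i.rev (-u) (Gen.T l.rev k.rev (-v))
    · exact genLam_central c D i.rev (-u) (Gen.lam k.rev (-v)))

theorem phiHom_comp (c : ℂ) (D : SpectralDomain) :
    (phiHom c D).comp (phiHom c D) = AlgHom.id ℂ (RTTAlg c D) := by
  apply RingQuot.ringQuot_ext'
  apply FreeAlgebra.hom_ext
  funext x
  cases x with
  | T i j u =>
    change phiHom c D (phiHom c D (genT c D u i j)) = genT c D u i j
    simp [phiHom, tilde, D.neg_neg]
  | lam i u =>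
    change phiHom c D (phiHom c D (genLam c D i u)) = genLam c D i u
    simp [phiHom, D.neg_neg]

/-- The automorphism `φ`. -/
def phi (c : ℂ) (D : SpectralDomain) : RTTAlg c D ≃ₐ[ℂ] RTTAlg c D :=
  AlgEquiv.ofAlgHom (phiHom c D) (phiHom c D) (phiHom_comp c D) (phiHom_comp c D)

theorem phi_genT (c : ℂ) (D : SpectralDomain) (i j : Fin 3) (u : D) :
    phi c D (genT c D u i j) = genT c D (-u) j.rev i.rev := by
  change phiHom c D _ = _
  simp [phiHom, tilde]

theorem phi_genLam (c : ℂ) (D : SpectralDomain) (i : Fin 3) (u : D) :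
    phi c D (genLam c D i u) = genLam c D i.rev (-u) := by
  change phiHom c D _ = _
  simp [phiHom]

/-! ### Formal vectors `X|0⟩` and the extension of `φ` to them -/

/-- The left ideal of the relations satisfied by the vacuum:
`T_{ij}(u)|0⟩ = 0` for `i > j` and `T_{ii}(u)|0⟩ = λ_i(u)|0⟩`. -/
def vacIdeal (c : ℂ) (D : SpectralDomain) : Submodule (RTTAlg c D) (RTTAlg c D) :=
  Submodule.span (RTTAlg c D)
    ({x | ∃ (i j : Fin 3) (u : D), j < i ∧ x = genT c D u i j} ∪
      {x | ∃ (i : Fin 3) (u : D), x = genT c D u i i - genLam c D i u})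

/-- The space of formal vectors `X|0⟩`, the universal module generated by a vacuum vector. -/
abbrev VacModule (c : ℂ) (D : SpectralDomain) : Type := RTTAlg c D ⧸ vacIdeal c D

/-- The vacuum vector `|0⟩`. -/
def vacuum (c : ℂ) (D : SpectralDomain) : VacModule c D := (vacIdeal c D).mkQ 1

/-- `φ` as a map of the algebra that is semilinear along itself. -/
def phiSemilinear (c : ℂ) (D : SpectralDomain) :
    RTTAlg c D →ₛₗ[((phi c D : RTTAlg c D →ₐ[ℂ] RTTAlg c D) : RTTAlg c D →+* RTTAlg c D)]
      RTTAlg c D where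
  toFun := phi c D
  map_add' := map_add _
  map_smul' := map_mul (phi c D)

theorem vacIdeal_le (c : ℂ) (D : SpectralDomain) :
    vacIdeal c D ≤ (vacIdeal c D).comap (phiSemilinear c D) := by
  refine Submodule.span_le.2 ?_
  rintro x (⟨i, j, u, hij, rfl⟩ | ⟨i, u, rfl⟩)
  · refine Submodule.subset_span (Or.inl ⟨j.rev, i.rev, -u, Fin.rev_lt_rev.2 hij, ?_⟩)
    exact phi_genT c D i j u
  · refine Submodule.subset_span (Or.inr ⟨i.rev, -u, ?_⟩)
    change phi c D _ = _
    rw [map_sub, phi_genT, phi_genLam]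

/-- The extension of `φ` to vectors, `φ(X|0⟩) = φ(X)|0⟩`. -/
def phiVec (c : ℂ) (D : SpectralDomain) :
    VacModule c D →ₛₗ[((phi c D : RTTAlg c D →ₐ[ℂ] RTTAlg c D) : RTTAlg c D →+* RTTAlg c D)]
      VacModule c D :=
  (vacIdeal c D).mapQ (vacIdeal c D) (phiSemilinear c D) (vacIdeal_le c D)

theorem phiVec_vacuum (c : ℂ) (D : SpectralDomain) :
    phiVec c D (vacuum c D) = vacuum c D := by
  change (vacIdeal c D).mkQ (phi c D 1) = _
  rw [map_one]; rfl

theorem phiVec_smul (c : ℂ) (D : SpectralDomain) (X : RTTAlg c D) (m : VacModule c D) :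
    phiVec c D (X • m) = phi c D X • phiVec c D m :=
  (phiVec c D).map_smulₛₗ X m

/-! ### Models -/

/-- A `gl₃`-invariant model: operators `T_{ij}(u)` on a complex vector space `H` that satisfy the
RTT relation, with a vacuum vector and vacuum eigenvalues `λ_i(u)`. -/
structure Model (c : ℂ) (D : SpectralDomain) (H : Type*) [AddCommGroup H] [Module ℂ H] where
  T : D → Matrix (Fin 3) (Fin 3) (Module.End ℂ H)
  rtt : IsRTT c T
  vac : H
  lam : Fin 3 → D → ℂ
  T_diag : ∀ (i : Fin 3) (u : D), T u i i vac = lam i u • vac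
  T_lower : ∀ (i j : Fin 3) (u : D), j < i → T u i j vac = 0

namespace Model

variable {c : ℂ} {D : SpectralDomain} {H : Type*} [AddCommGroup H] [Module ℂ H]

/-- The transformed model, with monodromy matrix `T̃_{ij}(u) = T_{4-j,4-i}(-u)`, the same vacuum
vector, and vacuum eigenvalues `λ̃_i(u) = λ_{4-i}(-u)`. -/
protected def tilde (M : Model c D H) : Model c D H where
  T := NABA.tilde M.T
  rtt := M.rtt.tilde
  vac := M.vac
  lam i u := M.lam i.rev (-u)
  T_diag i u := M.T_diag i.rev (-u)
  T_lower i j u hij := M.T_lower j.rev i.rev (-u) (Fin.rev_lt_rev.2 hij)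

/-- The off-shell Bethe vector `|Ψ_{a,b}(ū;v̄)⟩` of a model. -/
def bethe (M : Model c D H) {a b : ℕ} (u : Fin a → D) (v : Fin b → D) : H :=
  betheVector c M.T M.vac u v

/-- The representation of the algebra in a model. -/
def evalAlg (M : Model c D H) : RTTAlg c D →ₐ[ℂ] Module.End ℂ H :=
  liftAlg M.T (fun i u => algebraMap ℂ (Module.End ℂ H) (M.lam i u)) M.rtt
    (fun i u _ => Algebra.commutes (M.lam i u) _)

/-- `X ↦ X|0⟩` in a model. -/
def applyVac (M : Model c D H) :
    RTTAlg c D →ₛₗ[(M.evalAlg : RTTAlg c D →+* Module.End ℂ H)] H where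
  toFun X := M.evalAlg X M.vac
  map_add' X Y := by simp
  map_smul' X Y := by simp

/-- The realization in a model of a formal vector: `X|0⟩ ↦ X|0⟩`. -/
def evalVec (M : Model c D H) :
    VacModule c D →ₛₗ[(M.evalAlg : RTTAlg c D →+* Module.End ℂ H)] H :=
  (vacIdeal c D).liftQ M.applyVac (by
    refine Submodule.span_le.2 ?_
    rintro x (⟨i, j, u, hij, rfl⟩ | ⟨i, u, rfl⟩)
    · change M.evalAlg _ M.vac = 0
      simp [evalAlg, M.T_lower i j u hij]
    · change M.evalAlg _ M.vac = 0
      simp [evalAlg, M.T_diag i u])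

end Model

end

end NABA

namespace NABA

noncomputable section

/-! ### Ordered products in a monoid -/

section Monoid

variable {α β M : Type*} [Monoid M]

/-! The nested construction is a single matrix element in disguise. Write `e₁, e₂, e₃` for the basis
of `ℂ³` (indices `0, 1, 2`), and let `𝐑` be the ordered product of all `R(v_k, u_j)` on `(ℂ³)^{⊗ (a
+ b)}`. The Bethe vector is `X|0⟩`, where `X` is the matrix element of `T(u_1) ⋯ T(u_a) T(v_1) ⋯
T(v_b) 𝐑` with row `e₁^a e₂^b` and column `e₂^a e₃^b` (`betheVector_eq_creation_smul`). Indeed `𝐑`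
preserves the span of `e₂, e₃` in the factors concerned, where it restricts to the matrices `r` of
the nested monodromy.

In this form the symmetry is visible. The RTT relation moves `𝐑` to the left and exchanges the two
groups of monodromy matrices (`site_prod_mul_crossR`). Transposing, reversing the basis of `ℂ³` and
exchanging the two groups of factors turns the result into the same matrix element for `T̃` with
parameters `(-v̄; -ū)`: the row and column states are interchanged accordingly, and `𝐑` goes to its
analogue since `g(-u,-v) = g(v,u)` (`crossR_neg_neg`). Hence `creation_tilde`, an identity in any
algebra with an RTT matrix. It gives the statement on `φ` when applied to the generators, and the
equality in a model when applied to its operators. -/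

theorem commute_list_map_prod (l : List α) (f : α → M) (x : M)
    (h : ∀ i ∈ l, Commute x (f i)) : Commute x (l.map f).prod := by
  apply Commute.list_prod_right
  simpa using h

theorem commute_list_map_reverse_prod (l : List α) (f : α → M) (x : M)
    (h : ∀ i ∈ l, Commute x (f i)) : Commute x (l.map f).reverse.prod := by
  apply Commute.list_prod_right
  simpa using h

theorem list_prod_map_mul_of_commute (l : List α) (hl : l.Nodup) (f h : α → M)
    (hc : ∀ i j, i ≠ j → Commute (f i) (h j)) :
    (l.map fun i => f i * h i).prod = (l.map f).prod * (l.map h).prod := by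
  induction l with
  | nil => simp
  | cons i l ih =>
    rw [List.nodup_cons] at hl
    have hi : Commute (h i) (l.map f).prod :=
      commute_list_map_prod l f _ fun j hj => (hc j i (by rintro rfl; exact hl.1 hj)).symm
    simp only [List.map_cons, List.prod_cons]
    rw [ih hl.2, mul_assoc, ← mul_assoc (h i), hi.eq]
    simp only [mul_assoc]

/-- Here `y` is one `T(v_k)`, the `x i` are the `T(u_i)` and the `r i` are the `R(v_k, u_i)`. The
reversed order of the `r i` brings each one next to its own `x i` when `y` is pulled through the `x
i` one at a time. -/
theorem list_prod_exchange_single (l : List α) (hl : l.Nodup) (x r : α → M) (y : M)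
    (h : ∀ i, x i * y * r i = r i * y * x i) (hc : ∀ i j, i ≠ j → Commute (x i) (r j)) :
    (l.map x).prod * (y * (l.map r).reverse.prod)
      = (l.map r).reverse.prod * y * (l.map x).prod := by
  induction l with
  | nil => simp
  | cons i l ih =>
    rw [List.nodup_cons] at hl
    have hne : ∀ j ∈ l, i ≠ j := by rintro j hj rfl; exact hl.1 hj
    have h1 : Commute (x i) (l.map r).reverse.prod :=
      commute_list_map_reverse_prod l r _ fun j hj => hc i j (hne j hj)
    have h2 : Commute (r i) (l.map x).prod :=
      commute_list_map_prod l x _ fun j hj => (hc j i (hne j hj).symm).symm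
    simp only [List.map_cons, List.prod_cons, List.reverse_cons, List.prod_append, List.prod_nil,
      mul_one]
    calc x i * (l.map x).prod * (y * ((l.map r).reverse.prod * r i))
        = x i * ((l.map x).prod * (y * (l.map r).reverse.prod)) * r i := by
          simp only [mul_assoc]
      _ = (x i * (l.map r).reverse.prod) * y * ((l.map x).prod * r i) := by
          rw [ih hl.2]; simp only [mul_assoc]
      _ = (l.map r).reverse.prod * (x i * y * r i) * (l.map x).prod := by
          rw [h1.eq, ← h2.eq]; simp only [mul_assoc]
      _ = _ := by rw [h]; simp only [mul_assoc]

theorem list_prod_exchange (l : List α) (w : M) (f h : α → M) (hw : ∀ k, w * f k = h k * w) :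
    w * (l.map f).prod = (l.map h).prod * w := by
  induction l with
  | nil => simp
  | cons k l ih =>
    simp only [List.map_cons, List.prod_cons]
    rw [← mul_assoc, hw, mul_assoc, ih, mul_assoc]

/-- An ordered product over a rectangle may be taken row by row or column by column. -/
theorem list_prod_rectangle (la : List α) (lb : List β) (ha : la.Nodup) (hb : lb.Nodup)
    (r : α → β → M) (hc : ∀ i j k l, i ≠ j → k ≠ l → Commute (r i k) (r j l)) :
    (lb.map fun k => (la.map fun i => r i k).reverse.prod).prod
      = (la.map fun i => (lb.map fun k => r i k).prod).reverse.prod := by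
  induction la with
  | nil => simp
  | cons i la ih =>
    rw [List.nodup_cons] at ha
    simp only [List.map_cons, List.reverse_cons, List.prod_append, List.prod_nil,
      mul_one, List.prod_cons]
    rw [← ih ha.2]
    exact list_prod_map_mul_of_commute lb hb (fun k => (la.map fun i => r i k).reverse.prod) (r i)
      fun k l hkl => (commute_list_map_reverse_prod la _ _ fun j hj =>
        hc i j l k (by rintro rfl; exact ha.1 hj) hkl.symm).symm

end Monoid

/-! ### Operators in tensor products, as matrices over configurations -/

section Site

variable {A : Type*} [Ring A] {ι n : Type*} [DecidableEq ι]

theorem comp_swap_eq_iff (i j : ι) (s t : ι → n) :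
    s ∘ Equiv.swap i j = t ↔ s = t ∘ Equiv.swap i j := by
  constructor <;> rintro rfl <;> ext m <;> simp

variable [Fintype ι] [DecidableEq n]

/-- The matrix `X` acting in the `i`-th tensor factor. -/
def site (i : ι) (X : Matrix n n A) : Matrix (ι → n) (ι → n) A :=
  Matrix.of fun s t => if ∀ m, m ≠ i → s m = t m then X (s i) (t i) else 0

/-- The permutation of the `i`-th and `j`-th tensor factors. -/
def sitePerm (A : Type*) [Ring A] (n : Type*) [DecidableEq n] (i j : ι) :
    Matrix (ι → n) (ι → n) A :=
  Matrix.of fun s t => if s ∘ Equiv.swap i j = t then 1 else 0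

variable [Fintype n]

theorem site_mul_apply (i : ι) (X : Matrix n n A) {κ : Type*} (M : Matrix (ι → n) κ A)
    (s : ι → n) (t : κ) :
    (site i X * M) s t = ∑ x, X (s i) x * M (Function.update s i x) t := by
  rw [Matrix.mul_apply]
  symm
  refine Fintype.sum_of_injective (fun x => Function.update s i x)
    (Function.update_injective s i) _ _ ?_ ?_
  · intro s' hs'
    have : ¬ ∀ m, m ≠ i → s m = s' m := by
      intro h
      refine hs' ⟨s' i, ?_⟩
      ext m
      by_cases hm : m = i
      · subst hm; simp
      · simp [hm, h m hm]
    simp [site, this]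
  · intro x
    have : ∀ m, m ≠ i → s m = Function.update s i x m := fun m hm => by simp [hm]
    rw [site, Matrix.of_apply, if_pos this, Function.update_self]

theorem sitePerm_mul_apply (i j : ι) {κ : Type*} (M : Matrix (ι → n) κ A) (s : ι → n) (t : κ) :
    (sitePerm A n i j * M) s t = M (s ∘ Equiv.swap i j) t := by
  simp [Matrix.mul_apply, sitePerm]

theorem mul_sitePerm_apply (i j : ι) {κ : Type*} (M : Matrix κ (ι → n) A) (s : κ) (t : ι → n) :
    (M * sitePerm A n i j) s t = M s (t ∘ Equiv.swap i j) := by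
  simp [Matrix.mul_apply, sitePerm, comp_swap_eq_iff]

/-- The ordered product of matrices acting in different tensor factors. -/
theorem list_prod_site_apply (l : List ι) (hl : l.Nodup) (X : ι → Matrix n n A) (s t : ι → n) :
    (l.map fun i => site i (X i)).prod s t
      = if ∀ m, m ∉ l → s m = t m then (l.map fun i => X i (s i) (t i)).prod else 0 := by
  induction l generalizing s with
  | nil => simp [Matrix.one_apply, funext_iff]
  | cons i l ih =>
    rw [List.nodup_cons] at hl
    simp only [List.map_cons, List.prod_cons]
    -- The remaining factors do not act in the `i`-th place, so the intermediate state there is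
    -- already the final one.
    rw [site_mul_apply, Finset.sum_eq_single (t i)]
    · rw [ih hl.2]
      have h1 : (l.map fun j => X j (Function.update s i (t i) j) (t j))
          = l.map fun j => X j (s j) (t j) := by
        refine List.map_congr_left fun j hj => ?_
        rw [Function.update_of_ne]
        rintro rfl; exact hl.1 hj
      rw [h1]
      have h2 : (∀ m, m ∉ l → Function.update s i (t i) m = t m)
          ↔ ∀ m, m ∉ i :: l → s m = t m := by
        refine forall_congr' fun m => ?_
        by_cases hm : m = i
        · subst hm; simp
        · simp [hm]
      simp only [h2, mul_ite, mul_zero]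
    · intro x _ hx
      rw [ih hl.2, if_neg, mul_zero]
      intro h
      exact hx (by simpa using h i hl.1)
    · simp

theorem site_mul_site_apply {i j : ι} (hij : i ≠ j) (X Y : Matrix n n A) (s t : ι → n) :
    (site i X * site j Y) s t
      = if ∀ m, m ≠ i → m ≠ j → s m = t m then X (s i) (t i) * Y (s j) (t j) else 0 := by
  have := list_prod_site_apply [i, j] (by simpa using hij) (fun k => if k = i then X else Y) s t
  simpa [hij.symm] using this

theorem commute_site_sitePerm {i j k : ι} (hki : k ≠ i) (hkj : k ≠ j) (X : Matrix n n A) :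
    Commute (site k X) (sitePerm A n i j) := by
  ext s t
  rw [mul_sitePerm_apply, sitePerm_mul_apply]
  have hk : Equiv.swap i j k = k := Equiv.swap_apply_of_ne_of_ne hki hkj
  have : (∀ m, m ≠ k → s m = (t ∘ Equiv.swap i j) m)
      ↔ ∀ m, m ≠ k → (s ∘ Equiv.swap i j) m = t m := by
    constructor
    · intro h m hm
      have := h (Equiv.swap i j m) (fun e => hm (by rw [← hk] at e; simpa using e))
      simpa using this
    · intro h m hm
      have := h (Equiv.swap i j m) (fun e => hm (by rw [← hk] at e; simpa using e))
      simpa using this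
  simp only [site, Matrix.of_apply, this]
  simp [hk]

theorem commute_sitePerm {i j k l : ι} (h : [i, j, k, l].Nodup) :
    Commute (sitePerm A n i j) (sitePerm A n k l) := by
  ext s t
  rw [sitePerm_mul_apply, mul_sitePerm_apply]
  have h : Equiv.swap i j * Equiv.swap k l = Equiv.swap k l * Equiv.swap i j :=
    (Equiv.Perm.disjoint_swap_swap h).commute.eq
  have h' : (s ∘ Equiv.swap i j) ∘ Equiv.swap k l = (s ∘ Equiv.swap k l) ∘ Equiv.swap i j := by
    rw [Function.comp_assoc, Function.comp_assoc, ← Equiv.Perm.coe_mul, h, Equiv.Perm.coe_mul]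
  simp only [sitePerm, Matrix.of_apply, h']
  simp only [comp_swap_eq_iff]

variable [Algebra ℂ A]

/-- The matrix `1 + g P` acting in the `i`-th and `j`-th tensor factors. -/
def siteR (A : Type*) [Ring A] [Algebra ℂ A] (n : Type*) [DecidableEq n] (w : ℂ) (i j : ι) :
    Matrix (ι → n) (ι → n) A :=
  1 + w • sitePerm A n i j

theorem siteR_map (w : ℂ) (i j : ι) :
    (algebraMap ℂ A).mapMatrix (siteR ℂ n w i j) = siteR A n w i j := by
  ext s t
  simp only [siteR, RingHom.mapMatrix_apply, Matrix.map_apply, Matrix.add_apply, Matrix.smul_apply,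
    Matrix.one_apply, sitePerm, Matrix.of_apply, map_add]
  split_ifs <;> simp [Algebra.algebraMap_eq_smul_one]

theorem commute_site_siteR {i j k : ι} (hki : k ≠ i) (hkj : k ≠ j) (w : ℂ) (X : Matrix n n A) :
    Commute (site k X) (siteR A n w i j) :=
  (Commute.one_right _).add_right ((commute_site_sitePerm hki hkj X).smul_right w)

theorem commute_siteR {i j k l : ι} (h : [i, j, k, l].Nodup) (w z : ℂ) :
    Commute (siteR A n w i j) (siteR A n z k l) :=
  (Commute.one_right _).add_right
    (((Commute.one_left _).add_left ((commute_sitePerm h).smul_left w)).smul_right z)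

/-- This is the RTT relation in two chosen factors, read from right to left. Both sides vanish
unless the two configurations agree in all other factors. -/
theorem site_mul_site_mul_siteR {c x y : ℂ} {X Y : Matrix (Fin 3) (Fin 3) A}
    (h : rttLeft c y x Y X = rttRight c y x Y X) {i j : ι} (hij : i ≠ j) :
    site i X * site j Y * siteR A (Fin 3) (g c y x) i j
      = siteR A (Fin 3) (g c y x) i j * site j Y * site i X := by
  ext s t
  rw [siteR, mul_assoc (1 + _), mul_add, add_mul, mul_one, one_mul, Matrix.mul_smul,
    Matrix.smul_mul]
  simp only [Matrix.add_apply, Matrix.smul_apply]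
  rw [mul_sitePerm_apply, sitePerm_mul_apply]
  simp only [site_mul_site_apply hij, site_mul_site_apply hij.symm]
  by_cases hst : ∀ m, m ≠ i → m ≠ j → s m = t m
  · have h1 : ∀ m, m ≠ i → m ≠ j → s m = (t ∘ Equiv.swap i j) m := fun m hi hj => by
      simp [Equiv.swap_apply_of_ne_of_ne hi hj, hst m hi hj]
    have h2 : ∀ m, m ≠ j → m ≠ i → (s ∘ Equiv.swap i j) m = t m := fun m hj hi => by
      simp [Equiv.swap_apply_of_ne_of_ne hi hj, hst m hi hj]
    rw [if_pos hst, if_pos h1, if_pos h2, if_pos fun m hj hi => hst m hi hj]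
    -- The parameter `y` comes first in `h`, so its first tensor factor is the place `j` of `Y`.
    have := congrFun (congrFun h (s j, s i)) (t j, t i)
    rw [rttLeft_apply, rttRight_apply] at this
    simpa using this.symm
  · have h1 : ¬ ∀ m, m ≠ i → m ≠ j → s m = (t ∘ Equiv.swap i j) m := fun h => hst
      fun m hi hj => by simpa [Equiv.swap_apply_of_ne_of_ne hi hj] using h m hi hj
    have h2 : ¬ ∀ m, m ≠ j → m ≠ i → (s ∘ Equiv.swap i j) m = t m := fun h => hst
      fun m hi hj => by simpa [Equiv.swap_apply_of_ne_of_ne hi hj] using h m hj hi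
    rw [if_neg hst, if_neg h1, if_neg h2, if_neg fun h => hst fun m hi hj => h m hj hi]

end Site

end

end NABA

namespace NABA

noncomputable section

/-! ### Exchange of the two groups of monodromy matrices -/

section Order

variable {A : Type*} [Ring A] {D : SpectralDomain} {a b : ℕ} {T : D → Matrix (Fin 3) (Fin 3) A}

theorem list_map_site_inl_mul_inr_apply (u : Fin a → D) (v : Fin b → D)
    (s t : Fin a ⊕ Fin b → Fin 3) :
    (((List.finRange a).map fun i => site (Sum.inl i : Fin a ⊕ Fin b) (T (u i))).prod
      * ((List.finRange b).map fun k => site (Sum.inr k : Fin a ⊕ Fin b) (T (v k))).prod) s t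
    = ((List.finRange a).map fun i => T (u i) (s (Sum.inl i)) (t (Sum.inl i))).prod
      * ((List.finRange b).map fun k => T (v k) (s (Sum.inr k)) (t (Sum.inr k))).prod := by
  have := list_prod_site_apply
    ((List.finRange a).map Sum.inl ++ (List.finRange b).map (Sum.inr : Fin b → Fin a ⊕ Fin b))
    (List.Nodup.append ((List.nodup_finRange a).map Sum.inl_injective)
      ((List.nodup_finRange b).map Sum.inr_injective) (by simp [List.disjoint_left]))
    (fun m => T (Sum.elim u v m)) s t
  simpa [Function.comp_def] using this

theorem list_map_site_inr_mul_inl_apply (u : Fin a → D) (v : Fin b → D)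
    (s t : Fin a ⊕ Fin b → Fin 3) :
    (((List.finRange b).map fun k => site (Sum.inr k : Fin a ⊕ Fin b) (T (v k))).prod
      * ((List.finRange a).map fun i => site (Sum.inl i : Fin a ⊕ Fin b) (T (u i))).prod) s t
    = ((List.finRange b).map fun k => T (v k) (s (Sum.inr k)) (t (Sum.inr k))).prod
      * ((List.finRange a).map fun i => T (u i) (s (Sum.inl i)) (t (Sum.inl i))).prod := by
  have := list_prod_site_apply
    ((List.finRange b).map (Sum.inr : Fin b → Fin a ⊕ Fin b) ++ (List.finRange a).map Sum.inl)
    (List.Nodup.append ((List.nodup_finRange b).map Sum.inr_injective)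
      ((List.nodup_finRange a).map Sum.inl_injective) (by simp [List.disjoint_left]))
    (fun m => T (Sum.elim u v m)) s t
  simpa [Function.comp_def] using this

end Order

section Exchange

variable {A : Type*} [Ring A] [Algebra ℂ A] {D : SpectralDomain} {a b : ℕ}

/-- The product of the matrices `R(v_k, u_j)` acting in the `j`-th and `(a + k)`-th factors of
`(ℂ³)^{⊗ (a + b)}`. -/
def crossR (A : Type*) [Ring A] [Algebra ℂ A] (c : ℂ) (u : Fin a → D) (v : Fin b → D) :
    Matrix (Fin a ⊕ Fin b → Fin 3) (Fin a ⊕ Fin b → Fin 3) A :=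
  ((List.finRange b).map fun k => ((List.finRange a).map fun i =>
    siteR A (Fin 3) (g c (v k) (u i)) (Sum.inl i : Fin a ⊕ Fin b) (Sum.inr k)).reverse.prod).prod

theorem crossR_map (c : ℂ) (u : Fin a → D) (v : Fin b → D) :
    (algebraMap ℂ A).mapMatrix (crossR ℂ c u v) = crossR A c u v := by
  simp only [crossR, map_list_prod, List.map_map, List.map_reverse, Function.comp_def, siteR_map]

theorem crossR_apply (c : ℂ) (u : Fin a → D) (v : Fin b → D) (s t : Fin a ⊕ Fin b → Fin 3) :
    crossR A c u v s t = algebraMap ℂ A (crossR ℂ c u v s t) := by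
  rw [← crossR_map]; rfl

theorem commute_siteR_inl_inr {i j : Fin a} {k l : Fin b} (hij : i ≠ j) (hkl : k ≠ l) (w z : ℂ) :
    Commute (siteR A (Fin 3) w (Sum.inl i : Fin a ⊕ Fin b) (Sum.inr k))
      (siteR A (Fin 3) z (Sum.inl j : Fin a ⊕ Fin b) (Sum.inr l)) :=
  commute_siteR (by simp [hij, hkl]) w z

/-- The transposition of `(ℂ³)^{⊗ (a + b)}` that reverses the order of the basis of `ℂ³` and
exchanges the two groups of factors maps the product of `R`-matrices to the one for the
transformed parameters. -/
theorem crossR_neg_neg (c : ℂ) (u : Fin a → D) (v : Fin b → D) (s t : Fin b ⊕ Fin a → Fin 3) :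
    crossR ℂ c (fun k => -v k) (fun i => -u i) s t
      = crossR ℂ c u v (Fin.rev ∘ t ∘ Sum.swap) (Fin.rev ∘ s ∘ Sum.swap) := by
  let e : (Fin b ⊕ Fin a → Fin 3) ≃ (Fin a ⊕ Fin b → Fin 3) :=
    Equiv.arrowCongr (Equiv.sumComm _ _) Fin.revPerm
  have he : ∀ s, e s = Fin.rev ∘ s ∘ Sum.swap := fun s => rfl
  have hR : ∀ (w : ℂ) (i : Fin a) (k : Fin b),
      Matrix.transpose (Matrix.reindexAlgEquiv ℂ ℂ e
        (siteR ℂ (Fin 3) w (Sum.inl k) (Sum.inr i)))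
        = siteR ℂ (Fin 3) w (Sum.inl i) (Sum.inr k) := by
    intro w i k
    ext s t
    have h0 : (e.symm t) ∘ Equiv.swap (Sum.inl k) (Sum.inr i)
        = e.symm (t ∘ Equiv.swap (Sum.inl i) (Sum.inr k)) := by
      ext m
      change ((Fin.rev (t (Sum.swap (Equiv.swap (Sum.inl k) (Sum.inr i) m))) : Fin 3) : ℕ)
        = (Fin.rev (t (Equiv.swap (Sum.inl i) (Sum.inr k) (Sum.swap m))) : Fin 3)
      rw [Function.Injective.map_swap (Equiv.sumComm (Fin b) (Fin a)).injective (f := Sum.swap),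
        Equiv.swap_comm]
      rfl
    have h1 : (e.symm t) ∘ Equiv.swap (Sum.inl k) (Sum.inr i) = e.symm s
        ↔ s ∘ Equiv.swap (Sum.inl i) (Sum.inr k) = t := by
      rw [h0, e.symm.apply_eq_iff_eq, comp_swap_eq_iff, eq_comm, comp_swap_eq_iff,
        ← comp_swap_eq_iff]
    simp [siteR, Matrix.one_apply, sitePerm, h1, eq_comm (a := t) (b := s)]
  have key : Matrix.transpose (Matrix.reindexAlgEquiv ℂ ℂ e
      (crossR ℂ c (fun k => -v k) (fun i => -u i))) = crossR ℂ c u v := by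
    -- Transposition reverses the order of the factors and leaves them grouped by `i`, while
    -- `crossR` for `(ū; v̄)` is grouped by `k`; the rectangle lemma reconciles the two.
    rw [crossR, crossR, list_prod_rectangle _ _ (List.nodup_finRange a) (List.nodup_finRange b)
      _ fun i j k l hij hkl => commute_siteR_inl_inr hij hkl _ _]
    simp only [map_list_prod, Matrix.transpose_list_prod, List.map_map, List.map_reverse,
      Function.comp_def, List.reverse_reverse, hR, D.coe_neg, g_neg_neg]
  rw [← key, ← he, ← he]
  simp

variable {c : ℂ} {T : D → Matrix (Fin 3) (Fin 3) A}

variable (c T) in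
theorem commute_site_inr_row (u : Fin a → D) (v : Fin b → D) (k l : Fin b) (hkl : k ≠ l) :
    Commute (site (Sum.inr k : Fin a ⊕ Fin b) (T (v k)))
      ((List.finRange a).map fun i => siteR A (Fin 3) (g c (v l) (u i))
        (Sum.inl i : Fin a ⊕ Fin b) (Sum.inr l)).reverse.prod :=
  commute_list_map_reverse_prod _ _ _ fun i _ =>
    commute_site_siteR (by simp) (by simpa using hkl) _ _

/-- Each `T(v_k)` commutes with the `R(v_l, u_i)` for `l ≠ k`, so it can be grouped with its own row
of `R`-matrices on either side. The product of the `T(u_i)` then passes one such group at a time. -/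
theorem site_prod_mul_crossR (hT : IsRTT c T) (u : Fin a → D) (v : Fin b → D)
    (huv : ∀ j k, v k ≠ u j) :
    ((List.finRange a).map fun i => site (Sum.inl i : Fin a ⊕ Fin b) (T (u i))).prod
      * ((List.finRange b).map fun k => site (Sum.inr k : Fin a ⊕ Fin b) (T (v k))).prod
      * crossR A c u v
    = crossR A c u v
      * (((List.finRange b).map fun k => site (Sum.inr k : Fin a ⊕ Fin b) (T (v k))).prod
      * ((List.finRange a).map fun i => site (Sum.inl i : Fin a ⊕ Fin b) (T (u i))).prod) := by
  rw [crossR, mul_assoc, ← list_prod_map_mul_of_commute _ (List.nodup_finRange b) _ _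
      (commute_site_inr_row c T u v),
    ← mul_assoc, ← list_prod_map_mul_of_commute _ (List.nodup_finRange b) _ _
      fun k l hkl => (commute_site_inr_row c T u v l k hkl.symm).symm]
  refine list_prod_exchange _ _ _ _ fun k => ?_
  refine list_prod_exchange_single _ (List.nodup_finRange a) _ _ _ (fun i => ?_) fun i j hij => ?_
  · exact site_mul_site_mul_siteR (hT (v k) (u i) (huv i k)) (by simp)
  · exact commute_site_siteR (by simpa using hij) (by simp) _ _

/-- The element of the algebra that creates the off-shell Bethe vector from the vacuum. -/
def creation (c : ℂ) (T : D → Matrix (Fin 3) (Fin 3) A) (u : Fin a → D) (v : Fin b → D) : A :=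
  ∑ q : Fin a ⊕ Fin b → Fin 3, crossR ℂ c u v q (Sum.elim (fun _ => 1) fun _ => 2) •
    (((List.finRange a).map fun i => T (u i) 0 (q (Sum.inl i))).prod
      * ((List.finRange b).map fun k => T (v k) 1 (q (Sum.inr k))).prod)

/-- The entries of `crossR A` are scalars, hence central, and may stand in front of the operators.
-/
theorem creation_eq_apply (u : Fin a → D) (v : Fin b → D) :
    creation c T u v
    = (((List.finRange a).map fun i => site (Sum.inl i : Fin a ⊕ Fin b) (T (u i))).prod
      * ((List.finRange b).map fun k => site (Sum.inr k : Fin a ⊕ Fin b) (T (v k))).prod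
      * crossR A c u v) (Sum.elim (fun _ => 0) fun _ => 1) (Sum.elim (fun _ => 1) fun _ => 2) := by
  rw [Matrix.mul_apply, creation]
  refine Finset.sum_congr rfl fun q _ => ?_
  rw [list_map_site_inl_mul_inr_apply, crossR_apply (A := A), ← Algebra.commutes, ← Algebra.smul_def]
  rfl

/-- After the exchange by RTT, the sums on the two sides match term by term under the bijection `e`
of intermediate configurations. -/
theorem creation_tilde (hT : IsRTT c T) (u : Fin a → D) (v : Fin b → D)
    (huv : ∀ j k, v k ≠ u j) :
    creation c (tilde T) (fun k => -v k) (fun i => -u i) = creation c T u v := by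
  rw [creation_eq_apply u v, site_prod_mul_crossR hT u v huv, Matrix.mul_apply, creation]
  let e : (Fin b ⊕ Fin a → Fin 3) ≃ (Fin a ⊕ Fin b → Fin 3) :=
    Equiv.arrowCongr (Equiv.sumComm _ _) Fin.revPerm
  have he : ∀ s, e s = Fin.rev ∘ s ∘ Sum.swap := fun s => rfl
  refine Fintype.sum_equiv e _ _ fun q => ?_
  rw [list_map_site_inr_mul_inl_apply, crossR_apply (A := A), ← Algebra.smul_def, crossR_neg_neg, he]
  -- The column state `e₂^b e₃^a` on the transformed side becomes the row state `e₁^a e₂^b`.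
  have h0 : Fin.rev ∘ (Sum.elim (fun _ => 1) fun _ => 2 : Fin b ⊕ Fin a → Fin 3) ∘ Sum.swap
      = Sum.elim (fun _ => 0) fun _ => 1 := by
    ext m; cases m <;> rfl
  rw [h0]
  simp only [tilde, D.neg_neg, Matrix.of_apply]
  rfl

theorem map_creation {B : Type*} [Ring B] [Algebra ℂ B] (f : A →ₐ[ℂ] B) (u : Fin a → D)
    (v : Fin b → D) : f (creation c T u v) = creation c (fun z => (T z).map f) u v := by
  simp [creation, map_list_prod, Function.comp_def]

end Exchange

end

end NABA

namespace NABA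

noncomputable section

/-! ### Operators diagonal in a given tensor factor -/

section FixesSite

variable {A : Type*} [Ring A] {ι n : Type*}

/-- The operator `M` acts diagonally in the `m`-th tensor factor. -/
def FixesSite (m : ι) (M : Matrix (ι → n) (ι → n) A) : Prop :=
  ∀ s t, s m ≠ t m → M s t = 0

theorem fixesSite_one [DecidableEq (ι → n)] (m : ι) :
    FixesSite m (1 : Matrix (ι → n) (ι → n) A) := fun s t h =>
  Matrix.one_apply_ne (by rintro rfl; exact h rfl)

theorem FixesSite.mul [Fintype (ι → n)] {m : ι} {M N : Matrix (ι → n) (ι → n) A}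
    (hM : FixesSite m M) (hN : FixesSite m N) : FixesSite m (M * N) := by
  intro s t h
  rw [Matrix.mul_apply]
  refine Finset.sum_eq_zero fun q _ => ?_
  by_cases hq : s m = q m
  · rw [hN q t (hq ▸ h), mul_zero]
  · rw [hM s q hq, zero_mul]

variable [Fintype ι] [DecidableEq ι] [DecidableEq n]

theorem fixesSite_list_prod [Fintype n] {m : ι} (l : List (Matrix (ι → n) (ι → n) A))
    (h : ∀ M ∈ l, FixesSite m M) : FixesSite m l.prod := by
  induction l with
  | nil => exact fixesSite_one m
  | cons M l ih =>
    rw [List.prod_cons]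
    exact (h M (by simp)).mul (ih fun N hN => h N (by simp [hN]))

theorem fixesSite_site {m i : ι} (h : m ≠ i) (X : Matrix n n A) : FixesSite m (site i X) := by
  intro s t hst
  rw [site, Matrix.of_apply, if_neg fun h' => hst (h' m h)]

theorem fixesSite_siteR [Algebra ℂ A] {m i j : ι} (hi : m ≠ i) (hj : m ≠ j) (w : ℂ) :
    FixesSite m (siteR A n w i j) := by
  intro s t hst
  have h1 : s ≠ t := by rintro rfl; exact hst rfl
  have h2 : s ∘ Equiv.swap i j ≠ t := by
    rintro rfl; exact hst (by simp [Equiv.swap_apply_of_ne_of_ne hi hj])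
  simp [siteR, sitePerm, h1, h2]

end FixesSite

theorem list_prod_mul_intertwine {A : Type*} [Ring A] {κ κ' α : Type*} [Fintype κ] [Fintype κ'] [DecidableEq κ]
    [DecidableEq κ'] (l : List α) (f : α → Matrix κ κ A) (h : α → Matrix κ' κ' A)
    (E : Matrix κ κ' A) (hE : ∀ i, f i * E = E * h i) :
    (l.map f).prod * E = E * (l.map h).prod := by
  induction l with
  | nil => simp
  | cons i l ih =>
    simp only [List.map_cons, List.prod_cons]
    rw [Matrix.mul_assoc, ih, ← Matrix.mul_assoc, hE, Matrix.mul_assoc]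

/-! ### The nested Bethe vector as a matrix element -/

section Nesting

variable {A : Type*} [Ring A] {a b : ℕ}

/-- The embedding of `ℂ² ⊗ (ℂ²)^{⊗ a}` in `(ℂ³)^{⊗ (a + b)}` given by `ℂ² = ⟨e₂, e₃⟩ ⊆ ℂ³`; the
auxiliary space is the `(a + k)`-th factor, and the state of the other factors is `γ`. -/
def nestEmb (A : Type*) [Ring A] (a : ℕ) (k : Fin b) (γ : Fin b → Fin 3) :
    Matrix (Fin a ⊕ Fin b → Fin 3) (Fin 2 × (Fin a → Fin 2)) A :=
  Matrix.of fun q p =>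
    if q = Sum.elim (Fin.succ ∘ p.2) (Function.update γ k p.1.succ) then 1 else 0

theorem nestEmb_config_injective (k : Fin b) (γ : Fin b → Fin 3) :
    Function.Injective fun p : Fin 2 × (Fin a → Fin 2) =>
      (Sum.elim (Fin.succ ∘ p.2) (Function.update γ k p.1.succ) : Fin a ⊕ Fin b → Fin 3) := by
  rintro ⟨σ, s⟩ ⟨τ, t⟩ h
  have h1 := congrFun h (Sum.inr k)
  have h2 : ∀ i, s i = t i := fun i => Fin.succ_injective _ (congrFun h (Sum.inl i))
  simp only [Sum.elim_inr, Function.update_self] at h1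
  rw [Prod.mk.injEq]
  exact ⟨Fin.succ_injective _ h1, funext h2⟩

theorem mul_nestEmb_apply {κ : Type*} (M : Matrix κ (Fin a ⊕ Fin b → Fin 3) A) (k : Fin b)
    (γ : Fin b → Fin 3) (q : κ) (p : Fin 2 × (Fin a → Fin 2)) :
    (M * nestEmb A a k γ) q p
      = M q (Sum.elim (Fin.succ ∘ p.2) (Function.update γ k p.1.succ)) := by
  simp only [Matrix.mul_apply, nestEmb, Matrix.of_apply, mul_ite, mul_one, mul_zero,
    Finset.sum_ite_eq', Finset.mem_univ, if_true]

theorem nestEmb_mul_apply {κ : Type*} (M : Matrix (Fin 2 × (Fin a → Fin 2)) κ A) (k : Fin b)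
    (γ : Fin b → Fin 3) (p : Fin 2 × (Fin a → Fin 2)) (x : κ) :
    (nestEmb A a k γ * M) (Sum.elim (Fin.succ ∘ p.2) (Function.update γ k p.1.succ)) x = M p x := by
  have : ∀ p', (Sum.elim (Fin.succ ∘ p.2) (Function.update γ k p.1.succ) : Fin a ⊕ Fin b → Fin 3)
      = Sum.elim (Fin.succ ∘ p'.2) (Function.update γ k p'.1.succ) ↔ p = p' := fun p' =>
    (nestEmb_config_injective k γ).eq_iff
  simp only [Matrix.mul_apply, nestEmb, Matrix.of_apply, this, ite_mul, one_mul, zero_mul,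
    Finset.sum_ite_eq, Finset.mem_univ, if_true]

theorem nestEmb_mul_apply_of_forall_ne {κ : Type*} (M : Matrix (Fin 2 × (Fin a → Fin 2)) κ A)
    (k : Fin b) (γ : Fin b → Fin 3) (q : Fin a ⊕ Fin b → Fin 3) (x : κ)
    (h : ∀ p : Fin 2 × (Fin a → Fin 2),
      q ≠ Sum.elim (Fin.succ ∘ p.2) (Function.update γ k p.1.succ)) :
    (nestEmb A a k γ * M) q x = 0 := by
  simp only [Matrix.mul_apply, nestEmb, Matrix.of_apply, h, if_false, zero_mul,
    Finset.sum_const_zero]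

variable [Algebra ℂ A] {D : SpectralDomain}

/-- A permutation of two factors preserves the subspace where both lie in `⟨e₂, e₃⟩`, and restricts
there to the permutation of `ℂ² ⊗ ℂ²`. -/
theorem siteR_mul_nestEmb (c : ℂ) (i : Fin a) (k : Fin b) (γ : Fin b → Fin 3) (z x : ℂ) :
    siteR A (Fin 3) (g c z x) (Sum.inl i : Fin a ⊕ Fin b) (Sum.inr k) * nestEmb A a k γ
      = nestEmb A a k γ * Matrix.compRingEquiv (Fin 2) (Fin a → Fin 2) A (rMat A c i z x) := by
  -- With the auxiliary index merged into the configuration, the units `E_{βα}` at position `(α, β)`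
  -- assemble to the permutation of `V₀` with the `i`-th factor.
  have hr : Matrix.compRingEquiv (Fin 2) (Fin a → Fin 2) A (rMat A c i z x)
      = 1 + g c z x • Matrix.of fun p p' : Fin 2 × (Fin a → Fin 2) =>
        if p = (p'.2 i, Function.update p'.2 i p'.1) then (1 : A) else 0 := by
    rw [rMat, map_add, map_one]
    congr 1
    ext ⟨α, s⟩ ⟨β, t⟩
    have : (s i = β ∧ t i = α ∧ ∀ m, m ≠ i → s m = t m)
        ↔ (α = t i ∧ s = Function.update t i β) := by
      rw [Function.eq_update_iff, eq_comm (a := α)]; tauto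
    simp [siteUnit, Prod.ext_iff, this]
  rw [hr, siteR, Matrix.add_mul, Matrix.mul_add, Matrix.one_mul, Matrix.mul_one, Matrix.smul_mul, Matrix.mul_smul]
  congr 2
  ext q ⟨β, t⟩
  rw [sitePerm_mul_apply]
  have h1 : (Sum.elim (Fin.succ ∘ t) (Function.update γ k β.succ) : Fin a ⊕ Fin b → Fin 3)
      ∘ Equiv.swap (Sum.inl i) (Sum.inr k)
      = Sum.elim (Fin.succ ∘ Function.update t i β) (Function.update γ k (t i).succ) := by
    ext m
    rcases m with m | m
    · by_cases hm : m = i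
      · subst hm; simp [-Sum.elim_update_right]
      · rw [Function.comp_apply, Equiv.swap_apply_of_ne_of_ne (by simpa using hm) (by simp)]
        simp [-Sum.elim_update_right, hm]
    · by_cases hm : m = k
      · subst hm; simp [-Sum.elim_update_right]
      · rw [Function.comp_apply, Equiv.swap_apply_of_ne_of_ne (by simp) (by simpa using hm)]
        simp [-Sum.elim_update_right, hm]
  simp only [Matrix.mul_apply, nestEmb, Matrix.of_apply, comp_swap_eq_iff, h1, mul_ite, mul_one,
    mul_zero, Finset.sum_ite_eq', Finset.mem_univ, if_true]

/-- `T(v_k)` acting in the `(a + k)`-th factor, times the product of the matrices `R(v_k, u_j)`. -/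
def layer (c : ℂ) (T : D → Matrix (Fin 3) (Fin 3) A) (u : Fin a → D) (v : Fin b → D) (k : Fin b) :
    Matrix (Fin a ⊕ Fin b → Fin 3) (Fin a ⊕ Fin b → Fin 3) A :=
  site (Sum.inr k) (T (v k)) * ((List.finRange a).map fun i =>
    siteR A (Fin 3) (g c (v k) (u i)) (Sum.inl i : Fin a ⊕ Fin b) (Sum.inr k)).reverse.prod

variable (c : ℂ) (T : D → Matrix (Fin 3) (Fin 3) A) (u : Fin a → D) (v : Fin b → D)

theorem list_prod_layer :
    ((List.finRange b).map (layer c T u v)).prod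
      = ((List.finRange b).map fun k => site (Sum.inr k : Fin a ⊕ Fin b) (T (v k))).prod
        * crossR A c u v :=
  list_prod_map_mul_of_commute _ (List.nodup_finRange b) _ _ (commute_site_inr_row c T u v)

theorem fixesSite_layer {k l : Fin b} (h : l ≠ k) :
    FixesSite (Sum.inr l : Fin a ⊕ Fin b) (layer c T u v k) := by
  have h' : (Sum.inr l : Fin a ⊕ Fin b) ≠ Sum.inr k := by simpa using h
  refine (fixesSite_site h' _).mul (fixesSite_list_prod _ fun M hM => ?_)
  simp only [List.mem_reverse, List.mem_map] at hM
  obtain ⟨i, -, rfl⟩ := hM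
  exact fixesSite_siteR (by simp) h' _

theorem layer_mul_nestEmb (k : Fin b) (γ : Fin b → Fin 3) :
    layer c T u v k * nestEmb A a k γ
      = site (Sum.inr k : Fin a ⊕ Fin b) (T (v k)) * (nestEmb A a k γ
        * Matrix.compRingEquiv (Fin 2) (Fin a → Fin 2) A
          (List.ofFn fun i : Fin a => rMat A c i (v k) (u i)).reverse.prod) := by
  rw [layer, Matrix.mul_assoc, ← List.map_reverse, list_prod_mul_intertwine _ _ _ _
    fun i => siteR_mul_nestEmb c i k γ (v k) (u i), map_list_prod, List.ofFn_eq_map,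
    ← List.map_reverse, List.map_map]
  rfl

/-- Row `e₂` and column `e₃` in the `(a + k)`-th factor select the upper right entry in the
auxiliary space. -/
theorem layer_apply (k : Fin b) (γ : Fin b → Fin 3) (s t : Fin a → Fin 2) :
    layer c T u v k (Sum.elim (Fin.succ ∘ s) (Function.update γ k 1))
      (Sum.elim (Fin.succ ∘ t) (Function.update γ k 2)) = Bhat c T u (v k) s t := by
  have h := mul_nestEmb_apply (layer c T u v k) k γ
    (Sum.elim (Fin.succ ∘ s) (Function.update γ k 1)) (1, t)
  rw [layer_mul_nestEmb, site_mul_apply] at h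
  refine Eq.trans h.symm ?_
  have h0 : ∀ x, Function.update (Sum.elim (Fin.succ ∘ s) (Function.update γ k 1)
      : Fin a ⊕ Fin b → Fin 3) (Sum.inr k) x = Sum.elim (Fin.succ ∘ s) (Function.update γ k x) := by
    intro x; rw [← Sum.elim_update_right, Function.update_idem]
  simp only [h0]
  -- The term in which the auxiliary factor is in the state `e₁` is outside the embedded subspace;
  -- the other two give the block `𝔻`.
  rw [Fin.sum_univ_succ, nestEmb_mul_apply_of_forall_ne, mul_zero, zero_add]
  · rw [Bhat, That, Matrix.mul_apply, Matrix.sum_apply]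
    refine Finset.sum_congr rfl fun σ _ => ?_
    rw [nestEmb_mul_apply _ k γ (σ, s), blockD, Matrix.of_apply, Matrix.diagonal_mul]
    simp
  · intro p h
    have := congrFun h (Sum.inr k)
    simp only [Sum.elim_inr, Function.update_self] at this
    exact Fin.succ_ne_zero _ this.symm

/-- The `R`-matrices keep the first `a` factors in `⟨e₂, e₃⟩`, and `T(v_k)` does not act there. -/
theorem layer_apply_of_forall_ne (k : Fin b) (γ : Fin b → Fin 3) (β : Fin a → Fin 3)
    (hβ : ∀ s : Fin a → Fin 2, β ≠ Fin.succ ∘ s) (t : Fin a → Fin 2) :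
    layer c T u v k (Sum.elim β (Function.update γ k 1))
      (Sum.elim (Fin.succ ∘ t) (Function.update γ k 2)) = 0 := by
  have h := mul_nestEmb_apply (layer c T u v k) k γ
    (Sum.elim β (Function.update γ k 1)) (1, t)
  rw [layer_mul_nestEmb, site_mul_apply] at h
  refine h.symm.trans (Finset.sum_eq_zero fun x _ => ?_)
  rw [nestEmb_mul_apply_of_forall_ne, mul_zero]
  intro p hp
  refine hβ p.2 (funext fun i => ?_)
  exact congrFun hp (Sum.inl i)

/-- Each layer takes its own auxiliary factor from `e₃` to `e₂` and is diagonal in the others, so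
the layers compose as the operators `ℬ̂` do. The vanishing statement is carried through the
induction to discard intermediate states outside `⟨e₂, e₃⟩`. -/
theorem list_prod_layer_apply (l : List (Fin b)) (hl : l.Nodup) (t : Fin a → Fin 2) :
    (∀ s : Fin a → Fin 2, (l.map (layer c T u v)).prod
      (Sum.elim (Fin.succ ∘ s) fun k => if k ∈ l then 1 else 2)
      (Sum.elim (Fin.succ ∘ t) fun _ => 2) = (l.map fun k => Bhat c T u (v k)).prod s t) ∧
    (∀ β : Fin a → Fin 3, (∀ s : Fin a → Fin 2, β ≠ Fin.succ ∘ s) →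
      (l.map (layer c T u v)).prod (Sum.elim β fun k => if k ∈ l then 1 else 2)
        (Sum.elim (Fin.succ ∘ t) fun _ => 2) = 0) := by
  induction l with
  | nil =>
    have hinj : ∀ s : Fin a → Fin 2, (Sum.elim (Fin.succ ∘ s) (fun _ => 2)
        : Fin a ⊕ Fin b → Fin 3) = Sum.elim (Fin.succ ∘ t) (fun _ => 2) ↔ s = t := by
      intro s
      refine ⟨fun h => funext fun i => Fin.succ_injective _ (congrFun h (Sum.inl i)), ?_⟩
      rintro rfl; rfl
    refine ⟨fun s => ?_, fun β hβ => ?_⟩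
    · simp [Matrix.one_apply, hinj]
    · refine Matrix.one_apply_ne fun h => hβ t (funext fun i => ?_)
      simpa using congrFun h (Sum.inl i)
  | cons k l ih =>
    rw [List.nodup_cons] at hl
    obtain ⟨ih1, ih2⟩ := ih hl.2
    set γ : Fin b → Fin 3 := fun m => if m ∈ l then 1 else 2 with hγ
    have hγ1 : (fun m => if m ∈ k :: l then 1 else 2 : Fin b → Fin 3) = Function.update γ k 1 := by
      ext m
      by_cases hm : m = k
      · subst hm; simp
      · simp [hm, hγ]
    have hγ2 : γ = Function.update γ k 2 := by simp [hγ, hl.1]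
    have hfix : FixesSite (Sum.inr k : Fin a ⊕ Fin b) (l.map (layer c T u v)).prod := by
      refine fixesSite_list_prod _ fun M hM => ?_
      obtain ⟨m, hm, rfl⟩ := List.mem_map.1 hM
      exact fixesSite_layer c T u v (by rintro rfl; exact hl.1 hm)
    have key : ∀ β : Fin a → Fin 3, ((k :: l).map (layer c T u v)).prod
        (Sum.elim β fun m => if m ∈ k :: l then 1 else 2) (Sum.elim (Fin.succ ∘ t) fun _ => 2)
        = ∑ s' : Fin a → Fin 2, layer c T u v k (Sum.elim β (Function.update γ k 1))
            (Sum.elim (Fin.succ ∘ s') (Function.update γ k 2))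
          * (l.map fun k => Bhat c T u (v k)).prod s' t := by
      intro β
      rw [List.map_cons, List.prod_cons, Matrix.mul_apply, hγ1]
      symm
      refine Fintype.sum_of_injective
        (fun s' => (Sum.elim (Fin.succ ∘ s') γ : Fin a ⊕ Fin b → Fin 3)) ?_ _ _ ?_ ?_
      · intro s s' h
        exact funext fun i => Fin.succ_injective _ (congrFun h (Sum.inl i))
      · intro q hq
        -- The auxiliary part of an intermediate state is forced to be `γ`: the tail of the product
        -- fixes the factor `k`, and the layer `k` fixes all the others.
        by_cases hqγ : q ∘ Sum.inr = γ
        · have hq' : q = Sum.elim (q ∘ Sum.inl) γ := by rw [← hqγ, Sum.elim_comp_inl_inr]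
          rw [hq', ih2, mul_zero]
          intro s hs
          exact hq ⟨s, (congrArg (Sum.elim · _) hs.symm).trans hq'.symm⟩
        · obtain ⟨m, hm⟩ := Function.ne_iff.1 hqγ
          by_cases hmk : m = k
          · subst hmk
            rw [hfix q _ (by simpa [hγ, hl.1] using hm), mul_zero]
          · rw [fixesSite_layer c T u v hmk _ q (by simpa [hmk] using Ne.symm hm), zero_mul]
      · intro s'
        rw [← hγ2]; exact congrArg _ (ih1 s').symm
    refine ⟨fun s => ?_, fun β hβ => ?_⟩
    · rw [key, List.map_cons, List.prod_cons, Matrix.mul_apply]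
      simp only [layer_apply]
    · rw [key]
      exact Finset.sum_eq_zero fun s' _ => by rw [layer_apply_of_forall_ne _ _ _ _ _ _ _ hβ, zero_mul]

variable {H : Type*} [AddCommGroup H] [Module A H]

/-- In the product of the `T(u_i)` with the layers, the former leave the last `b` factors in the
state `e₂`, and the latter allow only `e₂, e₃` in the first `a`. The surviving intermediate states
are those summed over in the Bethe vector, with `T_{12}` and `T_{13}` as the entries of `𝔹`. -/
theorem betheVector_eq_creation_smul (vac : H) :
    betheVector c T vac u v = creation c T u v • vac := by
  have hF : ∀ s, Fvec c T vac u v s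
      = ((List.finRange b).map fun k => Bhat c T u (v k)).prod s (fun _ => 0) • vac := by
    intro s
    rw [Fvec, Finset.sum_eq_single fun _ => 0]
    · simp [vacOmega, List.ofFn_eq_map]
    · intro t _ ht
      simp [vacOmega, ht]
    · simp
  have hlist := list_prod_layer_apply c T u v (List.finRange b) (List.nodup_finRange b) (fun _ => 0)
  simp only [List.mem_finRange, if_true] at hlist
  have hsite := list_prod_site_apply ((List.finRange a).map (Sum.inl : Fin a → Fin a ⊕ Fin b))
    ((List.nodup_finRange a).map Sum.inl_injective) (fun m => T (Sum.elim u v m))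
  rw [creation_eq_apply, mul_assoc, ← list_prod_layer, Matrix.mul_apply, betheVector]
  simp only [hF, smul_smul, ← Finset.sum_smul]
  congr 1
  refine Fintype.sum_of_injective
    (fun s' => (Sum.elim (Fin.succ ∘ s') (fun _ => 1) : Fin a ⊕ Fin b → Fin 3)) ?_ _ _ ?_ ?_
  · intro s s' h
    exact funext fun i => Fin.succ_injective _ (congrFun h (Sum.inl i))
  · intro q hq
    by_cases hq1 : q ∘ Sum.inr = fun _ => 1
    · have hq' : q = Sum.elim (q ∘ Sum.inl) fun _ => 1 := by rw [← hq1, Sum.elim_comp_inl_inr]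
      have h2 := hlist.2 (q ∘ Sum.inl) fun s hs => hq ⟨s, (congrArg (Sum.elim · _) hs.symm).trans hq'.symm⟩
      rw [← hq'] at h2
      refine Eq.trans (congrArg _ ?_) (mul_zero _)
      exact h2
    · obtain ⟨m, hm⟩ := Function.ne_iff.1 hq1
      have := hsite (Sum.elim (fun _ => 0) fun _ => 1) q
      rw [if_neg fun h => hm (by simpa using (h (Sum.inr m) (by simp)).symm)] at this
      simp only [List.map_map, Function.comp_def, Sum.elim_inl] at this
      rw [this, zero_mul]
  · intro s
    have := hsite (Sum.elim (fun _ => 0) fun _ => 1) (Sum.elim (Fin.succ ∘ s) (fun _ => 1))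
    rw [if_pos (by rintro (m | m) <;> simp)] at this
    simp only [List.map_map, Function.comp_def, Sum.elim_inl] at this
    rw [List.ofFn_eq_map, Function.comp_def, this, ← hlist.1 s]
    rfl

end Nesting

/-! ### Realization of formal Bethe vectors in a model -/

theorem evalVec_betheVector {c : ℂ} {D : SpectralDomain} {H : Type*} [AddCommGroup H] [Module ℂ H]
    (M : Model c D H) {a b : ℕ} (u : Fin a → D) (v : Fin b → D) :
    M.evalVec (betheVector c (genT c D) (vacuum c D) u v) = M.bethe u v := by
  rw [Model.bethe, betheVector_eq_creation_smul, betheVector_eq_creation_smul,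
    LinearMap.map_smulₛₗ]
  have hvac : M.evalVec (vacuum c D) = M.vac := by
    change M.evalAlg 1 M.vac = M.vac
    simp
  have hT : (fun z => (genT c D z).map M.evalAlg) = M.T := by
    funext z; ext1 i j; simp [Model.evalAlg]
  rw [hvac, ← hT, ← map_creation M.evalAlg]
  rfl

end

end NABA

theorem mainTheorem5 (c : ℂ) (D : NABA.SpectralDomain) (a b : ℕ)
    (u : Fin a → D) (v : Fin b → D) (huv : ∀ j k, v k ≠ u j) :
    NABA.phiVec c D (NABA.betheVector c (NABA.genT c D) (NABA.vacuum c D) u v)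
        = NABA.betheVector c (NABA.genT c D) (NABA.vacuum c D)
            (fun k => -v k) (fun j => -u j) ∧
    ∀ (H : Type*) [AddCommGroup H] [Module ℂ H] (M : NABA.Model c D H),
      M.evalVec (NABA.betheVector c (NABA.genT c D) (NABA.vacuum c D) u v) = M.bethe u v ∧
      M.evalVec (NABA.phiVec c D
          (NABA.betheVector c (NABA.genT c D) (NABA.vacuum c D) u v))
        = M.bethe (fun k => -v k) (fun j => -u j) ∧
      M.tilde.evalVec (NABA.phiVec c D
          (NABA.betheVector c (NABA.genT c D) (NABA.vacuum c D) u v))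
        = M.tilde.bethe (fun k => -v k) (fun j => -u j) ∧
      M.bethe u v = M.tilde.bethe (fun k => -v k) (fun j => -u j) := by
  have hphi : NABA.phiVec c D (NABA.betheVector c (NABA.genT c D) (NABA.vacuum c D) u v)
      = NABA.betheVector c (NABA.genT c D) (NABA.vacuum c D) (fun k => -v k) (fun j => -u j) := by
    have hT : (fun z => (NABA.genT c D z).map (NABA.phi c D : NABA.RTTAlg c D →ₐ[ℂ] NABA.RTTAlg c D))
        = NABA.tilde (NABA.genT c D) := by
      funext z; ext1 i j; exact NABA.phi_genT c D i j z
    have hTT : NABA.tilde (NABA.tilde (NABA.genT c D)) = NABA.genT c D := by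
      funext z; ext1 i j; simp [NABA.tilde, D.neg_neg]
    rw [NABA.betheVector_eq_creation_smul, NABA.betheVector_eq_creation_smul, NABA.phiVec_smul,
      NABA.phiVec_vacuum]
    congr 1
    refine (NABA.map_creation (NABA.phi c D : NABA.RTTAlg c D →ₐ[ℂ] NABA.RTTAlg c D) u v).trans ?_
    -- The exchange identity is applied to `T̃` rather than `T`; as the transformation is an
    -- involution, its other side is built from the generators themselves.
    rw [hT, ← NABA.creation_tilde (NABA.genT_isRTT c D).tilde u v huv, hTT]
  refine ⟨hphi, fun H _ _ M => ⟨NABA.evalVec_betheVector M u v, ?_, ?_, ?_⟩⟩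
  · rw [hphi, NABA.evalVec_betheVector]
  · rw [hphi, NABA.evalVec_betheVector]
  · rw [NABA.Model.bethe, NABA.Model.bethe, NABA.betheVector_eq_creation_smul,
      NABA.betheVector_eq_creation_smul, ← NABA.creation_tilde M.rtt u v huv]
    rfl
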